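/- Let $V$ be a finite set, let the edges of the complete graph on $V$ be partitioned into $E^+$ and $E^-$, and let $w$ assign to the edges weights that form a pseudometric on $V$ ($w_{uv}\ge 0$ and $w_{wu}\le w_{uv}+w_{vw}$ for all $u,v,w$). For a vector $x=(x_{uv})$ put $$\mathrm{LP}(x)=\sum_{uv\in E^+}w_{uv}\,x_{uv}+\sum_{uv\in E^-}w_{uv}\,(1-x_{uv}),$$ and call $x$ feasible if $x_{uv}\in[0,1]$ and $x_{wu}\le x_{uv}+x_{vw}$ for all $u,v,w$ (with $x_{uu}=0$). The cost $\mathrm{obj}(\mathcal C)$ of a clustering (partition) $\mathcal C$ of $V$ is $\mathrm{LP}(x)$ for the vector $x$ with $x_{uv}=0$ if $u,v$ lie in a common cluster of $\mathcal C$ and $x_{uv}=1$ otherwise. Let $$f^+(x)=f^-(x)=\begin{cases}0,&x<0.4,\\ \tfrac53x,&0.4\le x<0.6,\\ 1,&x\ge 0.6.\end{cases}$$ The randomized algorithm LP-Pivot, on input $(V,E^+,E^-,x)$, picks a pivot $v\in V$ uniformly at random, sets $C=\{v\}$, adds each other vertex $u$ to $C$ independently with probability $1-p_{uv}$, where $p_{uv}=f^+(x_{uv})$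 if $uv\in E^+$ and $p_{uv}=f^-(x_{uv})$ if $uv\in E^-$, outputs the cluster $C$, and recurses on $V\setminus C$ until no vertex is left. Then LP-Pivot with these rounding functions is an expected $\frac{10}{3}$-approximation: for every feasible $x$ the output $\mathcal C$ is a clustering of $V$ with $\mathbb E[\mathrm{obj}(\mathcal C)]\le\frac{10}{3}\,\mathrm{LP}(x)$; in particular, if $x$ is an optimal solution of the LP of minimizing $\mathrm{LP}(x)$ over all feasible $x$, then $\mathbb E[\mathrm{obj}(\mathcal C)]\le\frac{10}{3}\,\mathrm{obj}(\mathcal C')$ for every clustering $\mathcal C'$ of $V$. -/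

import Mathlib

open scoped ENNReal

namespace CorrelationClustering

/-- A pseudometric on `V`, as a function of unordered pairs `s(u, v)`. -/
structure IsPseudometric {V : Type*} (d : Sym2 V → ℝ) : Prop where
  diag : ∀ u, d s(u, u) = 0
  nonneg : ∀ e, 0 ≤ d e
  triangle : ∀ u v w, d s(w, u) ≤ d s(u, v) + d s(v, w)

/-- Feasibility for the standard LP relaxation: the triangle inequality, and values in `[0, 1]`
(with the convention that the distance of a vertex to itself is `0`). -/
structure IsLPFeasible {V : Type*} (x : Sym2 V → ℝ) : Prop where
  pseudometric : IsPseudometric x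
  le_one : ∀ e, x e ≤ 1

section Objective

variable {V : Type*} [Fintype V] [DecidableEq V]

/-- The objective of the LP relaxation.
An instance is a complete graph on `V` whose edges are labelled `+` or `-`: `Gp` is the graph of the
`+` edges, its complement `Gpᶜ` is the graph of the `-` edges; `w` gives the edge weights. -/
def lpObj (Gp : SimpleGraph V) [DecidableRel Gp.Adj] (w x : Sym2 V → ℝ) : ℝ :=
  ∑ e ∈ Gp.edgeFinset, w e * x e + ∑ e ∈ Gpᶜ.edgeFinset, w e * (1 - x e)

open Classical in
/-- The 0-1 vector of a clustering: `0` on the pairs that lie in a common cluster, `1` on the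
others. -/
noncomputable def clusterDist (𝒞 : Finset (Finset V)) (e : Sym2 V) : ℝ :=
  if ∃ C ∈ 𝒞, ∀ u ∈ e, u ∈ C then 0 else 1

/-- The cost of a clustering: the total weight of the `+` edges between different clusters and of
the `-` edges inside a cluster. -/
noncomputable def cost (Gp : SimpleGraph V) [DecidableRel Gp.Adj] (w : Sym2 V → ℝ)
    (𝒞 : Finset (Finset V)) : ℝ :=
  lpObj Gp w (clusterDist 𝒞)

/-- `x` is an optimal solution of the LP relaxation. -/
def IsLPOptimal (Gp : SimpleGraph V) [DecidableRel Gp.Adj] (w x : Sym2 V → ℝ) : Prop :=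
  IsLPFeasible x ∧ ∀ y, IsLPFeasible y → lpObj Gp w x ≤ lpObj Gp w y

end Objective

section Algorithm

variable {V : Type*} [DecidableEq V]

/-- The weights of `randomSubset` below sum to one. -/
theorem sum_randomSubset (S : Finset V) (p : V → unitInterval) :
    ∑ T ∈ S.powerset, ((∏ u ∈ T, ENNReal.ofReal (1 - (p u : ℝ))) *
      ∏ u ∈ S \ T, ENNReal.ofReal (p u : ℝ)) = 1 := by
  rw [← Finset.prod_add]
  refine Finset.prod_eq_one fun u _ => ?_
  rw [← ENNReal.ofReal_add (by linarith [(p u).2.2]) (p u).2.1]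
  simp

/-- The random subset of `S` that contains each `u ∈ S`, independently, with probability
`1 - p u`. -/
noncomputable def randomSubset (S : Finset V) (p : V → unitInterval) : PMF (Finset V) :=
  PMF.ofFinset
    (fun T => if T ∈ S.powerset then
      (∏ u ∈ T, ENNReal.ofReal (1 - (p u : ℝ))) * ∏ u ∈ S \ T, ENNReal.ofReal (p u : ℝ) else 0)
    S.powerset
    (by rw [← sum_randomSubset S p]; exact Finset.sum_congr rfl fun T hT => if_pos hT)
    (fun _ hT => if_neg hT)

/-- The probability `p_e` with which a vertex is *not* put into the cluster of the pivot, where `e`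
is the edge between the two: `f⁺` is used on the `+` edges, `f⁻` on the `-` edges. -/
def rejectProb (fp fm : ℝ → unitInterval) (Gp : SimpleGraph V) [DecidableRel Gp.Adj]
    (x : Sym2 V → ℝ) (v u : V) : unitInterval :=
  if Gp.Adj u v then fp (x s(u, v)) else fm (x s(u, v))

/-- The distribution of the output of `LP-Pivot` on the sub-instance with vertex set `S`: pick a
pivot `v ∈ S` uniformly at random, put every other `u ∈ S` into its cluster `C` independently with
probability `1 - p_{uv}`, output `C` and recurse on `S \ C`. -/
noncomputable def lpPivot (fp fm : ℝ → unitInterval) (Gp : SimpleGraph V) [DecidableRel Gp.Adj]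
    (x : Sym2 V → ℝ) (S : Finset V) : PMF (Finset (Finset V)) :=
  if h : S.Nonempty then
    haveI : Nonempty S := h.to_subtype
    (PMF.uniformOfFintype S).bind fun v =>
      (randomSubset (S.erase v) (rejectProb fp fm Gp x v)).bind fun T =>
        (lpPivot fp fm Gp x (S \ insert (v : V) T)).map fun 𝒞 => insert (insert (v : V) T) 𝒞
  else PMF.pure ∅
termination_by S.card
decreasing_by
  refine Finset.card_lt_card ((Finset.ssubset_iff_of_subset Finset.sdiff_subset).2
    ⟨v, v.2, fun hv => (Finset.mem_sdiff.1 hv).2 (Finset.mem_insert_self _ _)⟩)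

end Algorithm

/-- The expected cost of a random clustering. -/
noncomputable def expectedCost {V : Type*} [Fintype V] [DecidableEq V] (Gp : SimpleGraph V)
    [DecidableRel Gp.Adj] (w : Sym2 V → ℝ) (μ : PMF (Finset (Finset V))) : ℝ :=
  ∑ 𝒞, (μ 𝒞).toReal * cost Gp w 𝒞

/-- The rounding function: `0` below `2/5`, then `(5/3) x` up to `3/5`, and `1` from there on
(its argument is a value of the LP variables, a number in `[0, 1]`). -/
noncomputable def roundFn (x : ℝ) : unitInterval :=
  ⟨if x < 2 / 5 then 0 else if x < 3 / 5 then 5 / 3 * x else 1, by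
    split_ifs
    · simp
    · constructor <;> linarith
    · simp⟩

end CorrelationClustering

open CorrelationClustering

/-!
The analysis charges the cost of the output to triples of vertices. Suppose that the current vertex
set is `S`, the pivot is `v`, and `C` is the new cluster. An edge `ab` inside `S` is decided in this
round when `C` contains `a` or `b`: from then on it pays either `0` or its weight, and its share of
the LP value leaves the instance. By induction on `S` it suffices that, for a uniformly random
pivot, the expected weight paid in a round is at most `10 / 3` times the expected LP value that
leaves (`expect_pairObj_lpPivot_le`).

The difference of the two sides on the edge `ab` is `w_ab` times a quantity `edgeExcess` that is
affine in the indicators of `a ∉ C` and `b ∉ C` and in their product. By independence its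
expectation is obtained by putting the rejection probabilities `p_va` and `p_vb` in place of the
indicators (`expect_edgeExcess`). Summing over all pivots and grouping the terms by triples `{v, a, b}`, it
remains to show `w_ab g_v + w_bv g_a + w_va g_b ≤ 0`, where `g_v` is the excess of the edge opposite
to `v`. Since `w` satisfies the triangle inequality, `(w_ab, w_bv, w_va)` is a nonnegative
combination of `(1, 1, 0)`, `(1, 0, 1)` and `(0, 1, 1)`, so that it is enough that any two of the
three excesses have a nonpositive sum (`excess_add_le`). This is a polynomial inequality on each
piece of the rounding function, and it holds for all choices of signs.

Sums run over ordered pairs and triples, degenerate ones included: these need no separate treatment,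
because `w` and `x` vanish on the diagonal and `roundFn 0 = 0`, so the pivot counts as a vertex that
is rejected with probability `0`.
-/

namespace CorrelationClustering

/-! ### The triangle inequality for the excess of an edge -/

/-- The excess of cost over `10 / 3` times removed LP value, in one round, for an edge of weight `1`
and LP value `x` whose sign is `+` if and only if `s` holds. The arguments `A` and `B` are the
indicators of the events that the two ends are left out of the new cluster, or, in expectation, the
probabilities of these events, when the events are independent. -/
noncomputable def edgeExcess (s : Prop) [Decidable s] (x A B : ℝ) : ℝ :=
  if s then A + B - 2 * A * B - 10 / 3 * x * (1 - A * B)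
  else (1 - A) * (1 - B) - 10 / 3 * (1 - x) * (1 - A * B)

/-- `A` is a value of the rounding function at `x`. The jump at `2 / 5` is closed up: both
one-sided limits are allowed for `A` there. On the middle piece `x` is written in terms of `A`. -/
inductive IsRounding (x A : ℝ) : Prop
  | low (hA : A = 0) (h0 : 0 ≤ x) (h1 : x ≤ 2 / 5)
  | mid (hx : x = 3 / 5 * A) (h0 : 2 / 3 ≤ A) (h1 : A ≤ 1)
  | high (hA : A = 1) (h0 : 3 / 5 ≤ x) (h1 : x ≤ 1)

theorem isRounding_roundFn {x : ℝ} (h0 : 0 ≤ x) (h1 : x ≤ 1) : IsRounding x (roundFn x) := by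
  unfold roundFn
  dsimp only
  split_ifs with h h'
  · exact .low rfl h0 h.le
  · exact .mid (by ring) (by linarith) (by linarith)
  · exact .high rfl (by linarith) h1

variable {s r : Prop} [Decidable s] [Decidable r] {y z t A B T : ℝ}

/-- Two edges `ab` and `ca` of a triangle with LP values `y` and `z`, whose third side `t` is always
rounded to `0`: when `c` is the pivot, `b` joins its cluster, and vice versa. -/
theorem excess_add_low (hy : IsRounding y B) (hz : IsRounding z A) (h0 : 0 ≤ t) (h1 : t ≤ 2 / 5)
    (hyz : y ≤ z + t) (hzy : z ≤ y + t) (ht : t ≤ y + z) :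
    edgeExcess s y A 0 + edgeExcess r z B 0 ≤ 0 := by
  unfold edgeExcess
  rcases hy with ⟨rfl, a0, a1⟩ | ⟨rfl, a0, a1⟩ | ⟨rfl, a0, a1⟩ <;>
  rcases hz with ⟨rfl, b0, b1⟩ | ⟨rfl, b0, b1⟩ | ⟨rfl, b0, b1⟩ <;>
  split_ifs <;> linarith

set_option maxHeartbeats 4000000 in
-- 36 polynomial inequalities are certified by products of the bounds on the variables
/-- Two edges of a triangle whose third side is rounded to a probability `T` on the middle piece. -/
theorem excess_add_mid (hy : IsRounding y B) (hz : IsRounding z A) (h0 : 2 / 3 ≤ T) (h1 : T ≤ 1)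
    (hyz : y ≤ z + 3 / 5 * T) (hzy : z ≤ y + 3 / 5 * T) (ht : 3 / 5 * T ≤ y + z) :
    edgeExcess s y A T + edgeExcess r z B T ≤ 0 := by
  unfold edgeExcess
  rcases hy with ⟨rfl, a0, a1⟩ | ⟨rfl, a0, a1⟩ | ⟨rfl, a0, a1⟩ <;>
  rcases hz with ⟨rfl, b0, b1⟩ | ⟨rfl, b0, b1⟩ | ⟨rfl, b0, b1⟩ <;>
  split_ifs <;>
  nlinarith [mul_nonneg (sub_nonneg.2 a0) (sub_nonneg.2 b0),
    mul_nonneg (sub_nonneg.2 a0) (sub_nonneg.2 h0), mul_nonneg (sub_nonneg.2 b0) (sub_nonneg.2 h0),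
    mul_nonneg (sub_nonneg.2 a1) (sub_nonneg.2 b1), mul_nonneg (sub_nonneg.2 a1) (sub_nonneg.2 h1),
    mul_nonneg (sub_nonneg.2 b1) (sub_nonneg.2 h1)]

/-- Two edges of a triangle whose third side `t` is always rounded to `1`. The constant `10 / 3` is
tight here: if `y + z = t = 3 / 5` and both edges are `+` and rounded to `0`, the sum vanishes. -/
theorem excess_add_high (hy : IsRounding y B) (hz : IsRounding z A) (h0 : 3 / 5 ≤ t) (h1 : t ≤ 1)
    (hyz : y ≤ z + t) (hzy : z ≤ y + t) (ht : t ≤ y + z) :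
    edgeExcess s y A 1 + edgeExcess r z B 1 ≤ 0 := by
  unfold edgeExcess
  rcases hy with ⟨rfl, a0, a1⟩ | ⟨rfl, a0, a1⟩ | ⟨rfl, a0, a1⟩ <;>
  rcases hz with ⟨rfl, b0, b1⟩ | ⟨rfl, b0, b1⟩ | ⟨rfl, b0, b1⟩ <;>
  split_ifs <;>
  nlinarith [mul_nonneg (sub_nonneg.2 a0) (sub_nonneg.2 b0),
    mul_nonneg (sub_nonneg.2 a0) (sub_nonneg.2 h0), mul_nonneg (sub_nonneg.2 b0) (sub_nonneg.2 h0),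
    mul_nonneg (sub_nonneg.2 a1) (sub_nonneg.2 b1)]

/-- In a triangle `abc`, the excess of `ab` for the pivot `c` and that of `ca` for the pivot `b`
have a nonpositive sum, whatever the signs of the two edges. -/
theorem excess_add_le {V : Type*} {x : Sym2 V → ℝ} (hx : IsLPFeasible x) (s r : Prop) [Decidable s]
    [Decidable r] (a b c : V) :
    edgeExcess s (x s(a, b)) (roundFn (x s(c, a))) (roundFn (x s(c, b))) +
    edgeExcess r (x s(c, a)) (roundFn (x s(a, b))) (roundFn (x s(c, b))) ≤ 0 := by
  have key := fun e => isRounding_roundFn (hx.pseudometric.nonneg e) (hx.le_one e)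
  have h1 := hx.pseudometric.triangle b c a
  have h2 := hx.pseudometric.triangle a b c
  have h3 := hx.pseudometric.triangle b a c
  simp only [Sym2.eq_swap (a := b) (b := a), Sym2.eq_swap (a := a) (b := c),
    Sym2.eq_swap (a := b) (b := c)] at h1 h2 h3
  rcases key s(c, b) with ⟨hA, h0, h1⟩ | ⟨hA, h0, h1⟩ | ⟨hA, h0, h1⟩
  · rw [hA]
    exact excess_add_low (key _) (key _) h0 h1 (by linarith) (by linarith) (by linarith)
  · exact excess_add_mid (key _) (key _) h0 h1 (by linarith) (by linarith) (by linarith)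
  · rw [hA]
    exact excess_add_high (key _) (key _) h0 h1 (by linarith) (by linarith) (by linarith)

theorem edgeExcess_comm (s : Prop) [Decidable s] (x A B : ℝ) :
    edgeExcess s x A B = edgeExcess s x B A := by
  unfold edgeExcess
  split_ifs <;> ring

/-- The metrics on three points form the cone generated by `(1, 1, 0)`, `(1, 0, 1)` and `(0, 1, 1)`:
a linear form that is nonpositive on these three is nonpositive on every metric. -/
theorem weighted_sum_nonpos {α β γ p q r : ℝ} (h1 : α ≤ β + γ) (h2 : β ≤ α + γ) (h3 : γ ≤ α + β)
    (hpq : p + q ≤ 0) (hpr : p + r ≤ 0) (hqr : q + r ≤ 0) : α * p + β * q + γ * r ≤ 0 := by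
  nlinarith [mul_nonneg (sub_nonneg.2 h1) (neg_nonneg.2 hqr),
    mul_nonneg (sub_nonneg.2 h2) (neg_nonneg.2 hpr),
    mul_nonneg (sub_nonneg.2 h3) (neg_nonneg.2 hpq)]

/-! ### Expectations over finite types -/

section Expectation

variable {α β : Type*} [Fintype α] [Fintype β]

/-- The expected value of `f` under `μ`. -/
noncomputable def expect (μ : PMF α) (f : α → ℝ) : ℝ := ∑ a, (μ a).toReal * f a

theorem sum_toReal (μ : PMF α) : ∑ a, (μ a).toReal = 1 := by
  rw [← ENNReal.toReal_sum fun a _ => μ.apply_ne_top a, ← tsum_fintype (L := .unconditional α),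
    μ.tsum_coe, ENNReal.toReal_one]

theorem expect_pure (a : α) (f : α → ℝ) : expect (PMF.pure a) f = f a := by
  classical
  rw [expect, Finset.sum_eq_single a] <;> simp +contextual [PMF.pure_apply]

theorem expect_bind (μ : PMF α) (κ : α → PMF β) (f : β → ℝ) :
    expect (μ.bind κ) f = expect μ fun a => expect (κ a) f := by
  simp only [expect, PMF.bind_apply, tsum_fintype, Finset.mul_sum]
  rw [Finset.sum_comm]
  refine Finset.sum_congr rfl fun b _ => ?_
  rw [ENNReal.toReal_sum fun a _ => ENNReal.mul_ne_top (μ.apply_ne_top a) ((κ a).apply_ne_top b),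
    Finset.sum_mul]
  simp only [ENNReal.toReal_mul, mul_assoc]

theorem expect_map (μ : PMF α) (g : α → β) (f : β → ℝ) :
    expect (μ.map g) f = expect μ fun a => f (g a) := by
  rw [← PMF.bind_pure_comp, expect_bind]
  simp only [Function.comp_apply, expect_pure]

theorem expect_mono {μ : PMF α} {f g : α → ℝ} (h : ∀ a ∈ μ.support, f a ≤ g a) :
    expect μ f ≤ expect μ g := by
  refine Finset.sum_le_sum fun a _ => ?_
  by_cases ha : a ∈ μ.support
  · exact mul_le_mul_of_nonneg_left (h a ha) ENNReal.toReal_nonneg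
  · simp [(μ.apply_eq_zero_iff a).2 ha]

theorem expect_add (μ : PMF α) (f g : α → ℝ) :
    expect μ (fun a => f a + g a) = expect μ f + expect μ g := by
  simp only [expect, mul_add, Finset.sum_add_distrib]

theorem expect_const (μ : PMF α) (c : ℝ) : expect μ (fun _ => c) = c := by
  rw [expect, ← Finset.sum_mul, sum_toReal, one_mul]

theorem expect_const_mul (μ : PMF α) (c : ℝ) (f : α → ℝ) :
    expect μ (fun a => c * f a) = c * expect μ f := by
  simp only [expect, Finset.mul_sum, mul_left_comm]

theorem expect_sum {ι : Type*} (μ : PMF α) (s : Finset ι) (f : ι → α → ℝ) :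
    expect μ (fun a => ∑ i ∈ s, f i a) = ∑ i ∈ s, expect μ (f i) := by
  simp only [expect, Finset.mul_sum]
  exact Finset.sum_comm

theorem expect_uniformOfFintype [Nonempty α] (f : α → ℝ) :
    expect (PMF.uniformOfFintype α) f = (Fintype.card α : ℝ)⁻¹ * ∑ a, f a := by
  simp [expect, Finset.mul_sum]

end Expectation

variable {V : Type*} [DecidableEq V]

/-! ### The cost of one round -/

/-- The indicator of `a ∉ C`. -/
def notMemInd (C : Finset V) (a : V) : ℝ := if a ∈ C then 0 else 1

section Step

variable (Gp : SimpleGraph V) [DecidableRel Gp.Adj] (w : Sym2 V → ℝ)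

/-- The contribution of the ordered pair `(a, b)` to the LP objective at `y`, which is `0` for
`a = b` if `w` vanishes on the diagonal. -/
def pairCost (y : Sym2 V → ℝ) (a b : V) : ℝ :=
  w s(a, b) * if Gp.Adj a b then y s(a, b) else 1 - y s(a, b)

/-- The LP objective at `y` of the sub-instance on `S`, with every edge counted twice, once for each
ordering of its ends. -/
def pairObj (S : Finset V) (y : Sym2 V → ℝ) : ℝ :=
  ∑ a ∈ S, ∑ b ∈ S, pairCost Gp w y a b

theorem pairObj_sdiff (S C : Finset V) (y : Sym2 V → ℝ) :
    pairObj Gp w (S \ C) y =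
      ∑ a ∈ S, ∑ b ∈ S, notMemInd C a * notMemInd C b * pairCost Gp w y a b := by
  rw [pairObj, Finset.sdiff_eq_filter, Finset.sum_filter]
  refine Finset.sum_congr rfl fun a _ => ?_
  by_cases ha : a ∈ C
  · simp [notMemInd, ha]
  · rw [if_pos ha, Finset.sum_filter]
    refine Finset.sum_congr rfl fun b _ => ?_
    by_cases hb : b ∈ C <;> simp [notMemInd, ha, hb]

variable [Fintype V]

theorem clusterDist_mk (𝒞 : Finset (Finset V)) (a b : V) [Decidable (∃ C ∈ 𝒞, a ∈ C ∧ b ∈ C)] :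
    clusterDist 𝒞 s(a, b) = if ∃ C ∈ 𝒞, a ∈ C ∧ b ∈ C then 0 else 1 := by
  simp [clusterDist]

/-- Splits the cost of a pair into the part of the first cluster `C` and that of the clustering `𝒞`
of the remaining vertices. -/
theorem pairCost_insert {S C : Finset V} {𝒞 : Finset (Finset V)} (h𝒞 : ∀ D ∈ 𝒞, D ⊆ S \ C)
    (x : Sym2 V → ℝ) (a b : V) :
    pairCost Gp w (clusterDist (insert C 𝒞)) a b =
      w s(a, b) * edgeExcess (Gp.Adj a b) (x s(a, b)) (notMemInd C a) (notMemInd C b) +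
      notMemInd C a * notMemInd C b * pairCost Gp w (clusterDist 𝒞) a b +
      10 / 3 * (pairCost Gp w x a b - notMemInd C a * notMemInd C b * pairCost Gp w x a b) := by
  classical
  -- the first cluster decides every pair that it meets
  have key : ∀ c ∈ C, ∀ D ∈ 𝒞, c ∉ D := fun c hc D hD hcD =>
    (Finset.mem_sdiff.1 (h𝒞 D hD hcD)).2 hc
  have h : clusterDist (insert C 𝒞) s(a, b) =
      if a ∈ C then if b ∈ C then 0 else 1
      else if b ∈ C then 1 else clusterDist 𝒞 s(a, b) := by
    simp only [clusterDist_mk, Finset.exists_mem_insert]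
    have hor : a ∈ C ∨ b ∈ C → ¬ ∃ D ∈ 𝒞, a ∈ D ∧ b ∈ D := by
      rintro (hc | hc) ⟨D, hD, haD, hbD⟩
      exacts [key _ hc D hD haD, key _ hc D hD hbD]
    by_cases ha : a ∈ C <;> by_cases hb : b ∈ C <;> simp only [ha, hb] at hor ⊢ <;> simp_all
  unfold pairCost edgeExcess notMemInd
  rw [h]
  split_ifs <;> ring

theorem pairObj_insert {S C : Finset V} {𝒞 : Finset (Finset V)} (h𝒞 : ∀ D ∈ 𝒞, D ⊆ S \ C)
    (x : Sym2 V → ℝ) :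
    pairObj Gp w S (clusterDist (insert C 𝒞)) =
      (∑ a ∈ S, ∑ b ∈ S,
        w s(a, b) * edgeExcess (Gp.Adj a b) (x s(a, b)) (notMemInd C a) (notMemInd C b)) +
      pairObj Gp w (S \ C) (clusterDist 𝒞) +
      10 / 3 * (pairObj Gp w S x - pairObj Gp w (S \ C) x) := by
  rw [pairObj_sdiff, pairObj_sdiff, pairObj, pairObj]
  simp only [pairCost_insert Gp w h𝒞 x, Finset.sum_add_distrib, Finset.sum_sub_distrib,
    Finset.mul_sum, mul_sub]

end Step

/-! ### Independence in the random cluster -/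

section Moments

variable [Fintype V]

theorem expect_randomSubset (S : Finset V) (p : V → unitInterval) (f : Finset V → ℝ) :
    expect (randomSubset S p) f =
      ∑ T ∈ S.powerset, (∏ u ∈ T, (1 - (p u : ℝ))) * (∏ u ∈ S \ T, (p u : ℝ)) * f T := by
  rw [expect]
  symm
  refine Finset.sum_subset_zero_on_sdiff (Finset.subset_univ _) (fun T hT => ?_) fun T hT => ?_
  · have hT' : T ∉ S.powerset := (Finset.mem_sdiff.1 hT).2
    simp only [randomSubset, PMF.ofFinset_apply, if_neg hT', ENNReal.toReal_zero, zero_mul]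
  · simp only [randomSubset, PMF.ofFinset_apply, if_pos hT, ENNReal.toReal_mul, ENNReal.toReal_prod]
    have h1 : ∀ u, (ENNReal.ofReal (1 - (p u : ℝ))).toReal = 1 - (p u : ℝ) := fun u =>
      ENNReal.toReal_ofReal (by linarith [(p u).2.2])
    have h2 : ∀ u, (ENNReal.ofReal (p u : ℝ)).toReal = (p u : ℝ) := fun u =>
      ENNReal.toReal_ofReal (p u).2.1
    simp only [h1, h2]

/-- The cluster `insert v T` of the pivot `v` misses `D` with the product of the rejection
probabilities. The hypothesis `p v = 0` makes this true also if `v ∈ D`. -/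
theorem expect_prod_notMemInd {S D : Finset V} {v : V} {p : V → unitInterval} (hv : p v = 0)
    (hD : D ⊆ S) :
    expect (randomSubset (S.erase v) p) (fun T => ∏ u ∈ D, notMemInd (insert v T) u) =
      ∏ u ∈ D, (p u : ℝ) := by
  by_cases hvD : v ∈ D
  · rw [Finset.prod_eq_zero hvD (by simp [hv])]
    have : ∀ T : Finset V, ∏ u ∈ D, notMemInd (insert v T) u = 0 := fun T =>
      Finset.prod_eq_zero hvD (by simp [notMemInd])
    simp only [this, expect_const]
  · have hDS : D ⊆ S.erase v := fun u hu =>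
      Finset.mem_erase.2 ⟨fun h => hvD (h ▸ hu), hD hu⟩
    -- as a product over `T`, the indicator can be absorbed into the weights of `randomSubset`
    have hf : ∀ T : Finset V, ∏ u ∈ D, notMemInd (insert v T) u =
        ∏ u ∈ T, if u ∈ D then (0 : ℝ) else 1 := by
      intro T
      by_cases h : ∃ u ∈ T, u ∈ D
      · obtain ⟨u, hT, hD⟩ := h
        rw [Finset.prod_eq_zero hD (by simp [notMemInd, hT]),
          Finset.prod_eq_zero hT (by simp [hD])]
      · push Not at h
        rw [Finset.prod_eq_one, Finset.prod_eq_one]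
        · intro u hu; simp [h u hu]
        · intro u hu
          rw [notMemInd, if_neg]
          rw [Finset.mem_insert]
          rintro (rfl | hT)
          exacts [hvD hu, h u hT hu]
    rw [expect_randomSubset]
    simp only [hf, mul_right_comm, ← Finset.prod_mul_distrib]
    rw [← Finset.prod_add, ← Finset.prod_subset hDS]
    · exact Finset.prod_congr rfl fun u hu => by simp [hu]
    · intro u _ hu
      simp [hu]

theorem expect_edgeExcess {S : Finset V} {v a b : V} {p : V → unitInterval} (hv : p v = 0)
    (ha : a ∈ S) (hb : b ∈ S) (hab : a ≠ b) (s : Prop) [Decidable s] (x : ℝ) :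
    expect (randomSubset (S.erase v) p)
        (fun T => edgeExcess s x (notMemInd (insert v T) a) (notMemInd (insert v T) b)) =
      edgeExcess s x (p a) (p b) := by
  have h1 := expect_prod_notMemInd hv (Finset.singleton_subset_iff.2 ha)
  have h2 := expect_prod_notMemInd hv (Finset.singleton_subset_iff.2 hb)
  have h3 := expect_prod_notMemInd hv (Finset.insert_subset ha (Finset.singleton_subset_iff.2 hb))
  simp only [Finset.prod_singleton, Finset.prod_pair hab] at h1 h2 h3
  set μ := randomSubset (S.erase v) p
  -- `edgeExcess` is affine in `A`, `B` and `A * B`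
  have hlin : ∃ k l m : ℝ, ∀ A B, edgeExcess s x A B = k + (l * A + (l * B + m * (A * B))) := by
    by_cases hs : s
    · exact ⟨-(10 / 3 * x), 1, 10 / 3 * x - 2, fun A B => by rw [edgeExcess, if_pos hs]; ring⟩
    · exact ⟨1 - 10 / 3 * (1 - x), -1, 1 + 10 / 3 * (1 - x), fun A B => by
        rw [edgeExcess, if_neg hs]; ring⟩
  obtain ⟨k, l, m, hlin⟩ := hlin
  simp only [hlin, expect_add, expect_const, expect_const_mul, h1, h2, h3]

end Moments

/-! ### The induction over the rounds -/

section Pivot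

variable (Gp : SimpleGraph V) [DecidableRel Gp.Adj] {w x : Sym2 V → ℝ}

theorem rejectProb_same {V : Type*} (Gp : SimpleGraph V) [DecidableRel Gp.Adj] (x : Sym2 V → ℝ)
    (f : ℝ → unitInterval) (v u : V) : rejectProb f f Gp x v u = f (x s(v, u)) := by
  rw [rejectProb, ite_self, Sym2.eq_swap]

/-- Summed over all pivots, the expected excess of a round is nonpositive. -/
theorem sum_excess_nonpos {V : Type*} (Gp : SimpleGraph V) [DecidableRel Gp.Adj]
    {w x : Sym2 V → ℝ} (hw : IsPseudometric w) (hx : IsLPFeasible x) (S : Finset V) :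
    ∑ v ∈ S, ∑ a ∈ S, ∑ b ∈ S, w s(a, b) *
      edgeExcess (Gp.Adj a b) (x s(a, b)) (roundFn (x s(v, a))) (roundFn (x s(v, b))) ≤ 0 := by
  set φ : V → V → V → ℝ := fun v a b => w s(a, b) *
      edgeExcess (Gp.Adj a b) (x s(a, b)) (roundFn (x s(v, a))) (roundFn (x s(v, b))) with hφ
  -- averaging over the three cyclic rotations groups the terms by triples
  have h1 : ∑ v ∈ S, ∑ a ∈ S, ∑ b ∈ S, φ v a b = ∑ v ∈ S, ∑ a ∈ S, ∑ b ∈ S, φ a b v := by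
    rw [Finset.sum_comm_cycle]
  have h2 : ∑ v ∈ S, ∑ a ∈ S, ∑ b ∈ S, φ v a b = ∑ v ∈ S, ∑ a ∈ S, ∑ b ∈ S, φ b v a := by
    rw [h1, Finset.sum_comm_cycle]
  have h3 : ∑ v ∈ S, ∑ a ∈ S, ∑ b ∈ S, (φ v a b + φ a b v + φ b v a) ≤ 0 := by
    refine Finset.sum_nonpos fun v _ => Finset.sum_nonpos fun a _ => Finset.sum_nonpos fun b _ => ?_
    have e1 := excess_add_le hx (Gp.Adj a b) (Gp.Adj v a) a b v
    have e2 := excess_add_le hx (Gp.Adj a b) (Gp.Adj b v) b a v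
    have e3 := excess_add_le hx (Gp.Adj b v) (Gp.Adj v a) v b a
    have w1 := hw.triangle b v a
    have w2 := hw.triangle v a b
    have w3 := hw.triangle a b v
    simp only [hφ, Sym2.eq_swap (a := b) (b := a), Sym2.eq_swap (a := a) (b := v),
      Sym2.eq_swap (a := b) (b := v)] at e1 e2 e3 w1 w2 w3 ⊢
    rw [edgeExcess_comm _ _ (roundFn (x s(v, b))) (roundFn (x s(v, a)))] at e2
    rw [edgeExcess_comm _ _ (roundFn (x s(v, a))) (roundFn (x s(a, b)))] at e3
    rw [edgeExcess_comm _ _ (roundFn (x s(v, b))) (roundFn (x s(a, b)))] at e3 ⊢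
    exact weighted_sum_nonpos (by linarith) (by linarith) (by linarith) e2 (by linarith)
      (by linarith)
  simp only [Finset.sum_add_distrib] at h3
  linarith

theorem exists_finpartition_of_mem_support_lpPivot (fp fm : ℝ → unitInterval) (S : Finset V) :
    ∀ 𝒞 ∈ (lpPivot fp fm Gp x S).support, ∃ P : Finpartition S, P.parts = 𝒞 := by
  induction S using Finset.strongInduction with | H S ih =>
  intro 𝒞 h𝒞
  rw [lpPivot] at h𝒞
  split_ifs at h𝒞 with hS
  · simp only [PMF.mem_support_bind_iff, PMF.mem_support_map_iff] at h𝒞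
    obtain ⟨v, -, T, hT, 𝒟, h𝒟, rfl⟩ := h𝒞
    have hTS : T ⊆ S := by
      have : T ∈ (S.erase v).powerset := by
        by_contra h
        exact (PMF.mem_support_iff _ _).1 hT (by rw [randomSubset, PMF.ofFinset_apply, if_neg h])
      exact (Finset.mem_powerset.1 this).trans (Finset.erase_subset _ _)
    have hC : insert (v : V) T ⊆ S := Finset.insert_subset v.2 hTS
    obtain ⟨P, rfl⟩ := ih _ (Finset.sdiff_ssubset hC (Finset.insert_nonempty _ _)) 𝒟 h𝒟
    exact ⟨P.extend (Finset.insert_nonempty _ _).ne_empty disjoint_sdiff_self_left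
      (sdiff_sup_cancel hC), rfl⟩
  · obtain rfl := Finset.not_nonempty_iff_eq_empty.1 hS
    rw [PMF.mem_support_pure_iff] at h𝒞
    exact ⟨Finpartition.empty _, h𝒞.symm⟩

/-- The approximation guarantee on every sub-instance. -/
theorem expect_pairObj_lpPivot_le [Fintype V] (hw : IsPseudometric w) (hx : IsLPFeasible x)
    (S : Finset V) :
    expect (lpPivot roundFn roundFn Gp x S) (fun 𝒞 => pairObj Gp w S (clusterDist 𝒞)) ≤
      10 / 3 * pairObj Gp w S x := by
  induction S using Finset.strongInduction with | H S ih =>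
  rw [lpPivot]
  split_ifs with hS
  · have : Nonempty S := hS.to_subtype
    rw [expect_bind, expect_uniformOfFintype]
    -- for a fixed pivot: the induction hypothesis bounds what happens after the first cluster
    have hstep : ∀ v : S, expect
          ((randomSubset (S.erase v) (rejectProb roundFn roundFn Gp x v)).bind
          fun T => (lpPivot roundFn roundFn Gp x (S \ insert (v : V) T)).map
            fun 𝒞 => insert (insert (v : V) T) 𝒞)
          (fun 𝒞 => pairObj Gp w S (clusterDist 𝒞)) ≤
        (∑ a ∈ S, ∑ b ∈ S, w s(a, b) * edgeExcess (Gp.Adj a b) (x s(a, b))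
          (roundFn (x s(v, a))) (roundFn (x s(v, b)))) + 10 / 3 * pairObj Gp w S x := by
      intro v
      have hv : rejectProb roundFn roundFn Gp x v v = 0 := by
        rw [rejectProb_same, hx.pseudometric.diag]
        ext
        simp [roundFn]
      calc _ = expect (randomSubset (S.erase v) (rejectProb roundFn roundFn Gp x v)) fun T =>
            expect (lpPivot roundFn roundFn Gp x (S \ insert (v : V) T)) fun 𝒞 =>
              pairObj Gp w S (clusterDist (insert (insert (v : V) T) 𝒞)) := by
            simp only [expect_bind, expect_map]
        _ ≤ expect (randomSubset (S.erase v) (rejectProb roundFn roundFn Gp x v)) fun T =>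
            (∑ a ∈ S, ∑ b ∈ S, w s(a, b) * edgeExcess (Gp.Adj a b) (x s(a, b))
              (notMemInd (insert (v : V) T) a) (notMemInd (insert (v : V) T) b)) +
            10 / 3 * pairObj Gp w S x := by
            refine expect_mono fun T _ => ?_
            set C := insert (v : V) T with hC
            have hlt : S \ C ⊂ S := (Finset.ssubset_iff_of_subset Finset.sdiff_subset).2
              ⟨v, v.2, fun h => (Finset.mem_sdiff.1 h).2 (Finset.mem_insert_self _ _)⟩
            refine (expect_mono fun 𝒞 h𝒞 => ?_).trans (b := expect _ fun 𝒞 =>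
              ((∑ a ∈ S, ∑ b ∈ S, w s(a, b) * edgeExcess (Gp.Adj a b) (x s(a, b))
                (notMemInd C a) (notMemInd C b)) +
              10 / 3 * (pairObj Gp w S x - pairObj Gp w (S \ C) x)) +
              pairObj Gp w (S \ C) (clusterDist 𝒞)) ?_
            · obtain ⟨P, rfl⟩ := exists_finpartition_of_mem_support_lpPivot Gp _ _ _ _ h𝒞
              rw [pairObj_insert Gp w (fun D hD => P.le hD) x]
              exact le_of_eq (by ring)
            · rw [expect_add, expect_const]
              linarith [ih _ hlt]
        _ = _ := by
            rw [expect_add, expect_const, expect_sum]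
            simp only [expect_sum]
            congr 1
            refine Finset.sum_congr rfl fun a ha => Finset.sum_congr rfl fun b hb => ?_
            rw [expect_const_mul]
            -- for `a = b` the indicators are not independent, but the weight is zero
            by_cases hab : a = b
            · rw [hab, hw.diag, zero_mul, zero_mul]
            · rw [expect_edgeExcess hv ha hb hab, rejectProb_same, rejectProb_same]
    have hsum := sum_excess_nonpos Gp hw hx S
    have hcard : (0 : ℝ) < Fintype.card S := Nat.cast_pos.2 Fintype.card_pos
    rw [inv_mul_le_iff₀ hcard]
    refine (Finset.sum_le_sum fun v _ => hstep v).trans ?_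
    rw [Finset.sum_add_distrib, Finset.sum_const, Finset.card_univ, nsmul_eq_mul]
    rw [← Finset.sum_coe_sort S] at hsum
    linarith
  · obtain rfl := Finset.not_nonempty_iff_eq_empty.1 hS
    simp [expect_pure, pairObj]

end Pivot

/-! ### From ordered pairs to edges -/

section Main

variable [Fintype V] (Gp : SimpleGraph V) [DecidableRel Gp.Adj] {w : Sym2 V → ℝ}

theorem two_mul_sum_edgeFinset (G : SimpleGraph V) [DecidableRel G.Adj] (F : Sym2 V → ℝ) :
    2 * ∑ e ∈ G.edgeFinset, F e = ∑ a, ∑ b, if G.Adj a b then F s(a, b) else 0 := by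
  have h : ∑ d : G.Dart, F d.edge = ∑ a, ∑ b, if G.Adj a b then F s(a, b) else 0 := by
    rw [← Fintype.sum_prod_type' (f := fun a b => if G.Adj a b then F s(a, b) else 0),
      ← Finset.sum_filter]
    refine Finset.sum_bij' (fun d _ => d.toProd) (fun q hq => ⟨q, (Finset.mem_filter.1 hq).2⟩)
      ?_ ?_ ?_ ?_ ?_ <;> simp [SimpleGraph.Dart.edge]
  rw [← h, ← Finset.sum_fiberwise_of_maps_to (t := G.edgeFinset) (g := SimpleGraph.Dart.edge)
    fun d _ => G.mem_edgeFinset.2 d.edge_mem, Finset.mul_sum]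
  refine Finset.sum_congr rfl fun e he => ?_
  rw [Finset.sum_congr rfl fun d hd => by rw [(Finset.mem_filter.1 hd).2], Finset.sum_const,
    G.dart_edge_fiber_card e (G.mem_edgeFinset.1 he), nsmul_eq_mul, Nat.cast_ofNat]

theorem two_mul_lpObj (hw : IsPseudometric w) (y : Sym2 V → ℝ) :
    2 * lpObj Gp w y = pairObj Gp w Finset.univ y := by
  rw [lpObj, mul_add, two_mul_sum_edgeFinset, two_mul_sum_edgeFinset, pairObj]
  simp only [← Finset.sum_add_distrib]
  refine Finset.sum_congr rfl fun a _ => Finset.sum_congr rfl fun b _ => ?_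
  simp only [pairCost, SimpleGraph.compl_adj]
  by_cases hab : a = b
  · simp [hab, hw.diag]
  · by_cases h : Gp.Adj a b <;> simp [hab, h]

theorem isLPFeasible_clusterDist (P : Finpartition (Finset.univ : Finset V)) :
    IsLPFeasible (clusterDist P.parts) := by
  classical
  have h01 : ∀ e, 0 ≤ clusterDist P.parts e ∧ clusterDist P.parts e ≤ 1 := fun e => by
    unfold clusterDist
    split_ifs <;> norm_num
  refine ⟨⟨fun u => ?_, fun e => (h01 e).1, fun u v t => ?_⟩, fun e => (h01 e).2⟩
  · rw [clusterDist_mk, if_pos]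
    obtain ⟨C, hC, hu⟩ := P.exists_mem (Finset.mem_univ u)
    exact ⟨C, hC, hu, hu⟩
  · have := (h01 s(u, v)).1
    have := (h01 s(v, t)).1
    have := (h01 s(t, u)).2
    by_cases huv : ∃ C ∈ P.parts, u ∈ C ∧ v ∈ C
    · by_cases hvt : ∃ C ∈ P.parts, v ∈ C ∧ t ∈ C
      · obtain ⟨C, hC, hu, hv⟩ := huv
        obtain ⟨D, hD, hv', ht⟩ := hvt
        obtain rfl := P.eq_of_mem_parts hC hD hv hv'
        rw [clusterDist_mk P.parts t u, if_pos ⟨C, hC, ht, hu⟩]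
        linarith
      · rw [clusterDist_mk P.parts v t, if_neg hvt]
        linarith
    · rw [clusterDist_mk P.parts u v, if_neg huv]
      linarith

theorem expectedCost_lpPivot_le {x : Sym2 V → ℝ} (hw : IsPseudometric w) (hx : IsLPFeasible x) :
    expectedCost Gp w (lpPivot roundFn roundFn Gp x Finset.univ) ≤ 10 / 3 * lpObj Gp w x := by
  have h := expect_pairObj_lpPivot_le Gp hw hx Finset.univ
  simp only [← two_mul_lpObj Gp hw, expect_const_mul] at h
  change expect _ (cost Gp w) ≤ _
  unfold cost
  linarith

end Main

end CorrelationClustering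

theorem mainTheorem1 {V : Type*} [Fintype V] [DecidableEq V] (Gp : SimpleGraph V)
    [DecidableRel Gp.Adj] (w : Sym2 V → ℝ) (hw : IsPseudometric w) :
    -- on every feasible LP solution, the output is always a clustering of `V`,
    -- and its expected cost is at most `10/3` times the LP value
    (∀ x : Sym2 V → ℝ, IsLPFeasible x →
      (∀ 𝒞 ∈ (lpPivot roundFn roundFn Gp x Finset.univ).support,
        ∃ P : Finpartition (Finset.univ : Finset V), P.parts = 𝒞) ∧
      expectedCost Gp w (lpPivot roundFn roundFn Gp x Finset.univ) ≤ 10 / 3 * lpObj Gp w x) ∧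
    -- on an optimal LP solution, it is at most `10/3` times the cost of any clustering
    (∀ x : Sym2 V → ℝ, IsLPOptimal Gp w x →
      ∀ P : Finpartition (Finset.univ : Finset V),
        expectedCost Gp w (lpPivot roundFn roundFn Gp x Finset.univ) ≤
          10 / 3 * cost Gp w P.parts) := by
  refine ⟨fun x hx => ⟨exists_finpartition_of_mem_support_lpPivot Gp _ _ _,
    expectedCost_lpPivot_le Gp hw hx⟩, fun x hx P => ?_⟩
  have h := hx.2 _ (isLPFeasible_clusterDist P)
  have h' := expectedCost_lpPivot_le Gp hw hx.1
  unfold cost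
  linarith
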